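/- Let $d\ge 1$, let $q_1,\dots,q_d$ be pairwise coprime positive integers, $\Gamma=q_1\mathbb Z\oplus\cdots\oplus q_d\mathbb Z$ and $Q=q_1\cdots q_d$. Let $\Delta$ be the discrete Laplacian $(\Delta u)(n)=\sum_{\|n'-n\|_1=1}u(n')$ on $\mathbb Z^d$. For a $\Gamma$-periodic function $V:\mathbb Z^d\to\mathbb C$ and $k\in\mathbb R^d$, let $D_V(k)$ be the $Q\times Q$ matrix of $\Delta+V$ acting on the functions $u:\mathbb Z^d\to\mathbb C$ with $u(n+q_j\mathbf e_j)=e^{2\pi i k_j}u(n)$ for all $n\in\mathbb Z^d$ and $1\le j\le d$, where such a $u$ is identified with its values on $W=\{n\in\mathbb Z^d: 0\le n_j\le q_j-1\}$. Put $P_V(k,\lambda)=\det(D_V(k)-\lambda I)$. For non-empty $S\subset\{1,\dots,d\}$, two $\Gamma$-periodic functions $V$ and $Y$ are called generalized partially Fermi isospectral with respect to $S$ if there exist $\lambda_1,\lambda_2\in\mathbb C$ and $k_j^*\in\mathbb R$ for each $j\notin S$ such that $P_V(k,\lambda_1)=P_Y(k,\lambda_2)$ for all $k\in\mathbb R^d$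 with $k_j=k_j^*$ for every $j\notin S$. For $1\le s<t\le d$, a function $V$ on $\mathbb Z^d$ is called $(s,t)$-separable if there exist $V_s,V_t:\mathbb Z^{d-1}\to\mathbb C$ such that $$V(n)=V_s(n_1,\dots,n_{t-1},n_{t+1},\dots,n_d)+V_t(n_1,\dots,n_{s-1},n_{s+1},\dots,n_d)\qquad\text{for all } n\in\mathbb Z^d.$$ **Theorem.** Let $V$ and $Y$ be real-valued $\Gamma$-periodic functions on $\mathbb Z^d$ that are generalized partially Fermi isospectral with respect to a set $S\subset\{1,\dots,d\}$ with $\#S\ge 3$. Then for any $s,t\in S$ with $s<t$, if $V$ is $(s,t)$-separable, then $Y$ is also $(s,t)$-separable. -/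

import Mathlib

namespace PeriodicSchrodinger

noncomputable section

/-- A function on `ℤ^d` is `Γ`-periodic, where `Γ = q₁ℤ ⊕ ⋯ ⊕ q_dℤ`. -/
def IsPeriodic {α : Type*} {d : ℕ} (q : Fin d → ℕ) (V : (Fin d → ℤ) → α) : Prop :=
  ∀ (n : Fin d → ℤ) (j : Fin d), V (n + Pi.single j (q j : ℤ)) = V n

/-- The fundamental domain `W = {n ∈ ℤ^d : 0 ≤ n_j ≤ q_j - 1}`; it has `Q = q₁ ⋯ q_d` points. -/
def fundamentalDomain {d : ℕ} (q : Fin d → ℕ) : Finset (Fin d → ℤ) :=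
  Fintype.piFinset fun j => Finset.Ico (0 : ℤ) (q j : ℤ)

/-- The discrete Laplacian on functions on `ℤ^d`: `(Δu)(n)` is the sum of `u` over the `2d` points
at `ℓ¹`-distance one from `n`, which are `n ± e_j`. -/
def laplacian {d : ℕ} (u : (Fin d → ℤ) → ℂ) (n : Fin d → ℤ) : ℂ :=
  ∑ j : Fin d, (u (n + Pi.single j 1) + u (n - Pi.single j 1))

/-- The Schrödinger operator `Δ + V`. -/
def schrodinger {d : ℕ} (V u : (Fin d → ℤ) → ℂ) (n : Fin d → ℤ) : ℂ :=
  laplacian u n + V n * u n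

/-- The Floquet-Bloch boundary condition `u(n + q_j e_j) = e^{2πi k_j} u(n)` for all `j`, `n`. -/
def IsFloquet {d : ℕ} (q : Fin d → ℕ) (k : Fin d → ℂ) (u : (Fin d → ℤ) → ℂ) : Prop :=
  ∀ (n : Fin d → ℤ) (j : Fin d),
    u (n + Pi.single j (q j : ℤ)) = Complex.exp (2 * Real.pi * Complex.I * k j) * u n

/-- For `w` in the fundamental domain, the function on `ℤ^d` that satisfies the Floquet-Bloch
boundary condition and, on the fundamental domain, is `1` at `w` and `0` elsewhere. These functions
are a basis of the space of functions with that boundary condition. -/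
def floquetBasis {d : ℕ} (q : Fin d → ℕ) (k : Fin d → ℂ) (w m : Fin d → ℤ) : ℂ :=
  if (∀ j, m j % (q j : ℤ) = w j) then
    Complex.exp (2 * Real.pi * Complex.I * ∑ j, k j * ((m j / (q j : ℤ) : ℤ) : ℂ))
  else 0

theorem isFloquet_floquetBasis {d : ℕ} (q : Fin d → ℕ) (hq : ∀ j, 0 < q j) (k : Fin d → ℂ)
    (w : Fin d → ℤ) : IsFloquet q k (floquetBasis q k w) := by
  intro n i
  have hi : (q i : ℤ) ≠ 0 := by exact_mod_cast (hq i).ne'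
  have h1 : ∀ j, (n + Pi.single i (q i : ℤ) : Fin d → ℤ) j % (q j : ℤ) = n j % (q j : ℤ) := by
    intro j
    by_cases h : j = i
    · subst h; simp
    · simp [h]
  have h2 : ∀ j, k j * (((n + Pi.single i (q i : ℤ) : Fin d → ℤ) j / (q j : ℤ) : ℤ) : ℂ)
      = k j * ((n j / (q j : ℤ) : ℤ) : ℂ) + (if j = i then k i else 0) := by
    intro j
    by_cases h : j = i
    · subst h
      simp only [Pi.add_apply, Pi.single_eq_same, if_true]
      rw [Int.add_ediv_of_dvd_right (dvd_refl _), Int.ediv_self hi]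
      push_cast; ring
    · simp [h]
  simp only [floquetBasis, h1, h2, Finset.sum_add_distrib, Finset.sum_ite_eq', Finset.mem_univ,
    if_true, mul_ite, mul_zero, ← Complex.exp_add]
  congr 1
  congr 1
  ring

theorem floquetBasis_apply_mem {d : ℕ} (q : Fin d → ℕ) (k : Fin d → ℂ) (w m : Fin d → ℤ)
    (hm : m ∈ fundamentalDomain q) : floquetBasis q k w m = if m = w then 1 else 0 := by
  have h : ∀ j, 0 ≤ m j ∧ m j < (q j : ℤ) := by
    simpa [fundamentalDomain, Fintype.mem_piFinset] using hm
  have h1 : ∀ j, m j % (q j : ℤ) = m j := fun j => Int.emod_eq_of_lt (h j).1 (h j).2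
  have h2 : ∀ j, m j / (q j : ℤ) = 0 := fun j => Int.ediv_eq_zero_of_lt (h j).1 (h j).2
  simp [floquetBasis, h1, h2, funext_iff]

/-- The `Q × Q` Floquet matrix `D_V(k)`: the matrix of `Δ + V` on the functions with the
Floquet-Bloch boundary condition, in the basis above. Such a function is recovered from its values
on the fundamental domain, so column `w` lists the values there of `Δ + V` applied to the basis
function of `w`. -/
def floquetMatrix {d : ℕ} (q : Fin d → ℕ) (V : (Fin d → ℤ) → ℂ) (k : Fin d → ℂ) :
    Matrix (fundamentalDomain q) (fundamentalDomain q) ℂ :=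
  Matrix.of fun n w => schrodinger V (floquetBasis q k w) n

/-- `P_V(k, μ) = det (D_V(k) - μ I)`. -/
def floquetDet {d : ℕ} (q : Fin d → ℕ) (V : (Fin d → ℤ) → ℂ) (k : Fin d → ℂ) (μ : ℂ) : ℂ :=
  (floquetMatrix q V k - μ • (1 : Matrix (fundamentalDomain q) (fundamentalDomain q) ℂ)).det

/-- `V` and `Y` are generalized partially Fermi isospectral with respect to the set `S` of
coordinates: for some energies `μ₁, μ₂` and some fixed real quasimomenta `kstar j`, `j ∉ S` (the
values of `kstar` on `S` play no role), `P_V(k, μ₁) = P_Y(k, μ₂)` for all real `k` that agree with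
`kstar` outside `S`. -/
def GenPartiallyFermiIsospectral {d : ℕ} (q : Fin d → ℕ) (V Y : (Fin d → ℤ) → ℂ)
    (S : Finset (Fin d)) : Prop :=
  S.Nonempty ∧ ∃ (μ₁ μ₂ : ℂ) (kstar : Fin d → ℝ), ∀ k : Fin d → ℝ,
    (∀ j, j ∉ S → k j = kstar j) →
      floquetDet q V (fun j => (k j : ℂ)) μ₁ = floquetDet q Y (fun j => (k j : ℂ)) μ₂

/-- `(s,t)`-separability: `V = V_s + V_t`, where `V_s` is a function of the coordinates other than
`n_t`, and `V_t` is a function of the coordinates other than `n_s`. -/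
def IsSeparable {d : ℕ} (V : (Fin d → ℤ) → ℂ) (s t : Fin d) : Prop :=
  ∃ (Vs : ({j : Fin d // j ≠ t} → ℤ) → ℂ) (Vt : ({j : Fin d // j ≠ s} → ℤ) → ℂ),
    ∀ n : Fin d → ℤ, V n = Vs (fun j => n j) + Vt (fun j => n j)

end

end PeriodicSchrodinger

/-!
In momentum space the Floquet matrix is the sum of the diagonal matrix with entries
`L_n(z) + L_{-n}(z⁻¹)`, where `z_j = e^{2πi k_j / q_j}` and `L_n(z) = ∑_j e^{2πi n_j / q_j} z_j`, and
of the convolution matrix with entries `V̂(m - n)` (`floquetDet_eq`). By the identity theorem the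
hypothesis on real quasimomenta extends to all non-zero complex `z_j`, `j ∈ S`
(`GenPartiallyFermiIsospectral.exists_det_eq`), so these may be sent to infinity.

Separability in the directions `s`, `t` means that `V̂(l) = 0` whenever `l_s` and `l_t` are both
nontrivial. Fix such an `l`. There is a direction `w ∈ ℂ^S` with non-zero coordinates in which
`L_n(w)` vanishes only for those `n` that agree on `S` with `0` or with `l` (`exists_direction`):
if `L_n` is a combination of `L_0` and `L_l`, an affine map sends the roots of unity
`e^{2πi l_j / q_j}` to `e^{2πi n_j / q_j}`, `j ∈ S`. Since the `q_j` are coprime, three of the former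
are distinct, for which `#S ≥ 3` is needed, and an affine map that sends three points of the unit
circle to the unit circle is constant or a rotation about the origin
(`eq_or_eq_of_affine_circle`); coprimality then forces `n = 0` or `n = l` on `S`.

Along `z = T w + x u`, with `T → ∞` and `L_0(u) = 1`, `L_l(u) = c = ±1`, the leading coefficient of the
determinant is a non-zero constant times `det (x C + E)`, where `E` is the block of the bounded part
of the matrix on the frequencies with `L_n(w) = 0`, and `C` is diagonal with entries `1` and `c`
(`tendsto_det_along_path`). Hence the characteristic polynomials of `-C E`, and so the traces
of `(C E)²`, agree for `V` and `Y`. The difference of the traces for `c = 1` and `c = -1` is four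
times the sum of `V̂(n - n') V̂(n' - n)` over `n = l`, `n' = 0` on `S`, in which the kinetic terms and
the energies do not occur. For real potentials this is a sum of squares `|V̂(n - n')|²`, which
vanishes for `V` and hence, term by term, for `Y`.
-/

namespace PeriodicSchrodinger

noncomputable section

/-! ### Characters of the period lattice and Fourier inversion -/

/-- The root of unity `e^{2πi m / q_j}`. -/
def phase {d : ℕ} (q : Fin d → ℕ) (j : Fin d) (m : ℤ) : ℂ :=
  Complex.exp (2 * Real.pi * Complex.I * (m / q j))

/-- The character `x ↦ ∏_j e^{2πi m_j x_j / q_j}` of `ℤ^d / Γ` with frequency `m`. -/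
def character {d : ℕ} (q : Fin d → ℕ) (m x : Fin d → ℤ) : ℂ :=
  ∏ j, phase q j (m j * x j)

variable {d : ℕ} {q : Fin d → ℕ}

theorem phase_add (j : Fin d) (a b : ℤ) : phase q j (a + b) = phase q j a * phase q j b := by
  simp only [phase, ← Complex.exp_add]
  congr 1
  push_cast
  ring

@[simp] theorem phase_zero (j : Fin d) : phase q j 0 = 1 := by simp [phase]

theorem phase_ne_zero (j : Fin d) (a : ℤ) : phase q j a ≠ 0 := Complex.exp_ne_zero _

theorem phase_neg (j : Fin d) (a : ℤ) : phase q j (-a) = (phase q j a)⁻¹ := by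
  rw [phase, phase, ← Complex.exp_neg]
  congr 1
  push_cast
  ring

theorem conj_phase (j : Fin d) (a : ℤ) :
    (starRingEnd ℂ) (phase q j a) = phase q j (-a) := by
  rw [phase, phase, ← Complex.exp_conj]
  congr 1
  simp only [map_mul, map_div₀, Complex.conj_ofReal, Complex.conj_I, map_intCast, map_natCast,
    map_ofNat, Int.cast_neg]
  ring

theorem phase_mul_natCast (j : Fin d) (a : ℤ) (n : ℕ) :
    phase q j (n * a) = phase q j a ^ n := by
  rw [phase, phase, ← Complex.exp_nat_mul]
  congr 1
  push_cast
  ring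

theorem phase_eq_one_iff (hq : ∀ j, 0 < q j) (j : Fin d) (a : ℤ) :
    phase q j a = 1 ↔ (q j : ℤ) ∣ a := by
  have h1 : (q j : ℂ) ≠ 0 := by exact_mod_cast (hq j).ne'
  have h2 : (2 * Real.pi * Complex.I : ℂ) ≠ 0 := Complex.two_pi_I_ne_zero
  rw [phase, Complex.exp_eq_one_iff]
  constructor
  · rintro ⟨n, hn⟩
    refine ⟨n, ?_⟩
    rw [mul_comm (n : ℂ)] at hn
    have := mul_left_cancel₀ h2 hn
    rw [div_eq_iff h1] at this
    have h3 : (a : ℂ) = ((q j * n : ℤ) : ℂ) := by rw [this]; push_cast; ring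
    exact_mod_cast h3
  · rintro ⟨n, rfl⟩
    refine ⟨n, ?_⟩
    push_cast
    field_simp

theorem phase_pow (hq : ∀ j, 0 < q j) (j : Fin d) (a : ℤ) : phase q j a ^ q j = 1 := by
  rw [← phase_mul_natCast, phase_eq_one_iff hq]
  exact dvd_mul_right _ _

/-- A complex number that is both a `q_i`-th and a `q_j`-th root of unity is `1`. -/
theorem phase_eq_one_of_eq (hq : ∀ j, 0 < q j)
    (hcop : Pairwise fun i j => Nat.Coprime (q i) (q j)) {i j : Fin d} (hij : i ≠ j) {a b : ℤ}
    (h : phase q i a = phase q j b) : phase q i a = 1 := by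
  have h1 := phase_pow hq i a
  have h2 := phase_pow hq j b
  rw [← h] at h2
  have h3 := pow_gcd_eq_one.2 ⟨h1, h2⟩
  rwa [hcop hij, pow_one] at h3

theorem sum_phase (hq : ∀ j, 0 < q j) (j : Fin d) (a : ℤ) :
    ∑ m ∈ Finset.Ico (0 : ℤ) (q j : ℤ), phase q j (m * a)
      = if (q j : ℤ) ∣ a then (q j : ℂ) else 0 := by
  have h : ∑ m ∈ Finset.Ico (0 : ℤ) (q j : ℤ), phase q j (m * a)
      = ∑ i ∈ Finset.range (q j), phase q j a ^ i := by
    refine Finset.sum_nbij' Int.toNat (fun i : ℕ => (i : ℤ)) ?_ ?_ ?_ ?_ ?_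
    · intro m hm
      simp only [Finset.mem_Ico, Finset.mem_range] at *
      omega
    · intro m hm
      simp only [Finset.mem_Ico, Finset.mem_range] at *
      omega
    · intro m hm
      simp only [Finset.mem_Ico] at hm
      exact Int.toNat_of_nonneg hm.1
    · intro m _
      simp
    · intro m hm
      simp only [Finset.mem_Ico] at hm
      rw [← phase_mul_natCast, Int.toNat_of_nonneg hm.1]
  rw [h]
  split_ifs with h1
  · rw [(phase_eq_one_iff hq j a).2 h1]
    simp
  · have h2 : phase q j a - 1 ≠ 0 := sub_ne_zero.2 fun h3 => h1 ((phase_eq_one_iff hq j a).1 h3)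
    have h3 := geom_sum_mul (phase q j a) (q j)
    rw [phase_pow hq, sub_self] at h3
    exact (mul_eq_zero.1 h3).resolve_right h2

theorem mem_fundamentalDomain {x : Fin d → ℤ} :
    x ∈ fundamentalDomain q ↔ ∀ j, 0 ≤ x j ∧ x j < (q j : ℤ) := by
  simp [fundamentalDomain, Fintype.mem_piFinset]

theorem emod_mem_fundamentalDomain (hq : ∀ j, 0 < q j) (x : Fin d → ℤ) :
    (fun j => x j % (q j : ℤ)) ∈ fundamentalDomain q := by
  rw [mem_fundamentalDomain]
  intro j
  have : (0 : ℤ) < q j := by exact_mod_cast hq j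
  exact ⟨Int.emod_nonneg _ this.ne', Int.emod_lt_of_pos _ this⟩

theorem emod_of_mem_fundamentalDomain {x : Fin d → ℤ} (hx : x ∈ fundamentalDomain q) :
    (fun j => x j % (q j : ℤ)) = x := by
  rw [mem_fundamentalDomain] at hx
  funext j
  exact Int.emod_eq_of_lt (hx j).1 (hx j).2

theorem dvd_sub_iff_eq_of_mem {x n : Fin d → ℤ} (hx : x ∈ fundamentalDomain q) :
    (∀ j, (q j : ℤ) ∣ n j - x j) ↔ x = fun j => n j % (q j : ℤ) := by
  rw [funext_iff]
  refine forall_congr' fun j => ?_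
  have h := congrFun (emod_of_mem_fundamentalDomain hx) j
  rw [← Int.modEq_iff_dvd, Int.ModEq, h]

/-- Orthogonality of the characters of `ℤ^d / Γ`. -/
theorem sum_character (hq : ∀ j, 0 < q j) (x : Fin d → ℤ) :
    ∑ m ∈ fundamentalDomain q, character q m x
      = if ∀ j, (q j : ℤ) ∣ x j then ∏ j, (q j : ℂ) else 0 := by
  have h := Finset.prod_univ_sum (fun j => Finset.Ico (0 : ℤ) (q j : ℤ))
    (fun j m => phase q j (m * x j))
  simp only [fundamentalDomain, character]
  rw [← h]
  simp only [sum_phase hq]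
  split_ifs with h1
  · exact Finset.prod_congr rfl fun j _ => if_pos (h1 j)
  · obtain ⟨j, hj⟩ := not_forall.1 h1
    exact Finset.prod_eq_zero (Finset.mem_univ j) (if_neg hj)

theorem character_add_left (m n x : Fin d → ℤ) :
    character q (m + n) x = character q m x * character q n x := by
  simp [character, add_mul, phase_add, Finset.prod_mul_distrib]

theorem character_add_right (m x y : Fin d → ℤ) :
    character q m (x + y) = character q m x * character q m y := by
  simp [character, mul_add, phase_add, Finset.prod_mul_distrib]

theorem character_neg_right (m x : Fin d → ℤ) :
    character q m (-x) = character q (-m) x := by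
  simp [character]

theorem conj_character (m x : Fin d → ℤ) :
    (starRingEnd ℂ) (character q m x) = character q (-m) x := by
  simp [character, map_prod, conj_phase]

theorem character_single (m : Fin d → ℤ) (j : Fin d) (a : ℤ) :
    character q m (Pi.single j a) = phase q j (m j * a) := by
  rw [character, Finset.prod_eq_single j]
  · simp
  · intro i _ hi
    simp [hi]
  · simp

theorem isPeriodic_character (hq : ∀ j, 0 < q j) (m : Fin d → ℤ) :
    IsPeriodic q (character q m) := by
  intro n j
  rw [character_add_right, character_single, (phase_eq_one_iff hq _ _).2 (dvd_mul_left _ _),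
    mul_one]

theorem IsPeriodic.apply_emod {α : Type*} {U : (Fin d → ℤ) → α} (hU : IsPeriodic q U)
    (n : Fin d → ℤ) : U (fun j => n j % (q j : ℤ)) = U n := by
  have h : ∀ (A : Finset (Fin d)) (c : Fin d → ℤ) (n : Fin d → ℤ),
      U (n + ∑ j ∈ A, c j • Pi.single j (q j : ℤ)) = U n := by
    intro A c
    induction A using Finset.induction_on with
    | empty => simp
    | insert a A ha ih =>
      intro n
      rw [Finset.sum_insert ha, ← add_assoc, ih]
      have h1 : Function.Periodic U (Pi.single a (q a : ℤ)) := fun n => hU n a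
      exact h1.zsmul (c a) n
  rw [← h Finset.univ (fun j => n j / (q j : ℤ)) (fun j => n j % (q j : ℤ))]
  congr 1
  funext i
  simp only [Pi.add_apply, Finset.sum_apply, Pi.smul_apply, smul_eq_mul]
  rw [Finset.sum_eq_single i]
  · simp [Int.emod_add_ediv_mul]
  · intro j _ hj
    simp [hj.symm]
  · simp

/-- The Fourier coefficient `Q⁻¹ ∑_{x ∈ W} V(x) e^{-2πi ∑_j m_j x_j / q_j}` of a function on `ℤ^d`,
which is only used for `Γ`-periodic functions. -/
def fourierCoeff (q : Fin d → ℕ) (V : (Fin d → ℤ) → ℂ) (m : Fin d → ℤ) : ℂ :=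
  (∏ j, (q j : ℂ))⁻¹ * ∑ x ∈ fundamentalDomain q, V x * character q (-m) x

theorem prod_natCast_ne_zero (hq : ∀ j, 0 < q j) : (∏ j, (q j : ℂ)) ≠ 0 :=
  Finset.prod_ne_zero_iff.2 fun j _ => by exact_mod_cast (hq j).ne'

/-- Fourier inversion for the product of `V` and a character. -/
theorem sum_fourierCoeff_mul_character (hq : ∀ j, 0 < q j) {V : (Fin d → ℤ) → ℂ}
    (hV : IsPeriodic q V) (a n : Fin d → ℤ) :
    ∑ m ∈ fundamentalDomain q, fourierCoeff q V (m - a) * character q m n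
      = V n * character q a n := by
  have h0 := prod_natCast_ne_zero hq
  have h1 : ∀ m x : Fin d → ℤ, V x * character q (-(m - a)) x * character q m n
      = V x * character q a x * character q m (n - x) := by
    intro m x
    rw [neg_sub, sub_eq_add_neg a, sub_eq_add_neg n, character_add_left, character_add_right,
      character_neg_right]
    ring
  simp only [fourierCoeff, mul_assoc, Finset.sum_mul, ← Finset.mul_sum]
  simp only [← mul_assoc, h1]
  rw [Finset.sum_comm]
  simp only [← Finset.mul_sum, sum_character hq, Pi.sub_apply]
  have h2 : ∑ x ∈ fundamentalDomain q, V x * character q a x *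
      (if ∀ j, (q j : ℤ) ∣ n j - x j then ∏ j, (q j : ℂ) else 0)
      = V n * character q a n * ∏ j, (q j : ℂ) := by
    rw [Finset.sum_eq_single_of_mem _ (emod_mem_fundamentalDomain hq n)]
    · rw [if_pos ((dvd_sub_iff_eq_of_mem (emod_mem_fundamentalDomain hq n)).2 rfl),
        hV.apply_emod, (isPeriodic_character hq a).apply_emod]
    · intro x hx hne
      rw [if_neg fun h => hne ((dvd_sub_iff_eq_of_mem hx).1 h), mul_zero]
  rw [h2]
  field_simp

theorem conj_fourierCoeff (V : (Fin d → ℤ) → ℝ) (m : Fin d → ℤ) :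
    (starRingEnd ℂ) (fourierCoeff q (fun n => (V n : ℂ)) m)
      = fourierCoeff q (fun n => (V n : ℂ)) (-m) := by
  simp [fourierCoeff, map_prod, conj_character]

/-! ### Separability -/

theorem sum_fundamentalDomain_add (hq : ∀ j, 0 < q j) {U : (Fin d → ℤ) → ℂ}
    (hU : IsPeriodic q U) (y : Fin d → ℤ) :
    ∑ x ∈ fundamentalDomain q, U (x + y) = ∑ x ∈ fundamentalDomain q, U x := by
  refine Finset.sum_nbij' (fun x j => (x + y) j % (q j : ℤ)) (fun x j => (x - y) j % (q j : ℤ))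
    (fun x _ => emod_mem_fundamentalDomain hq _) (fun x _ => emod_mem_fundamentalDomain hq _)
    ?_ ?_ (fun x _ => (hU.apply_emod _).symm)
  · intro x hx
    nth_rewrite 2 [← emod_of_mem_fundamentalDomain hx]
    funext j
    simp
  · intro x hx
    nth_rewrite 2 [← emod_of_mem_fundamentalDomain hx]
    funext j
    simp

/-- A function is separable exactly when its mixed difference with respect to the base point `0` in
the coordinates `s` and `t` vanishes. -/
theorem isSeparable_iff {V : (Fin d → ℤ) → ℂ} {s t : Fin d} (hst : s ≠ t) :
    IsSeparable V s t ↔ ∀ n, V n = V (Function.update n t 0) + (V (Function.update n s 0)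
      - V (Function.update (Function.update n s 0) t 0)) := by
  constructor
  · rintro ⟨f, g, h⟩ n
    have hf : ∀ n : Fin d → ℤ, (fun j : {j : Fin d // j ≠ t} => Function.update n t 0 j.1)
        = fun j => n j.1 := fun n => funext fun j => by simp [j.2]
    have hg : ∀ n : Fin d → ℤ, (fun j : {j : Fin d // j ≠ s} => Function.update n s 0 j.1)
        = fun j => n j.1 := fun n => funext fun j => by simp [j.2]
    have hg' : (fun j : {j : Fin d // j ≠ s} =>
        Function.update (Function.update n s 0) t 0 j.1)
        = fun j => Function.update n t 0 j.1 := by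
      rw [Function.update_comm hst]
      exact hg _
    rw [h n, h (Function.update n t 0), h (Function.update n s 0), h (Function.update _ t 0),
      hf, hf, hg, hg']
    ring
  · intro h
    refine ⟨fun m => V fun j => if hj : j ≠ t then m ⟨j, hj⟩ else 0,
      fun m => V (fun j => if hj : j ≠ s then m ⟨j, hj⟩ else 0)
        - V (Function.update (fun j => if hj : j ≠ s then m ⟨j, hj⟩ else 0) t 0), fun n => ?_⟩
    have h1 : ∀ i, (fun j => if _hj : j ≠ i then n j else 0) = Function.update n i 0 := by
      intro i
      funext j
      by_cases hj : j = i
      · subst hj; simp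
      · simp [hj]
    simp only [h1]
    exact h n

/-- The Fourier coefficients of a periodic function that does not depend on the coordinate `t`
vanish at all frequencies that are nontrivial in the coordinate `t`. -/
theorem fourierCoeff_eq_zero_of_add_single (hq : ∀ j, 0 < q j) {V : (Fin d → ℤ) → ℂ}
    (hV : IsPeriodic q V) {t : Fin d} (h : ∀ x, V (x + Pi.single t 1) = V x)
    {m : Fin d → ℤ} (hm : ¬ (q t : ℤ) ∣ m t) : fourierCoeff q V m = 0 := by
  have hU : IsPeriodic q fun x => V x * character q (-m) x := fun n j => by
    simp only [hV n j, isPeriodic_character hq (-m) n j]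
  have h1 := sum_fundamentalDomain_add hq hU (Pi.single t 1)
  simp only [h, character_add_right, character_single, ← mul_assoc, ← Finset.sum_mul] at h1
  have h2 : phase q t ((-m) t * 1) ≠ 1 := by
    rw [Ne, phase_eq_one_iff hq]
    simpa using hm
  have h3 : (∑ x ∈ fundamentalDomain q, V x * character q (-m) x) = 0 := by
    by_contra h0
    exact h2 (mul_left_cancel₀ h0 (h1.trans (mul_one _).symm))
  rw [fourierCoeff, h3, mul_zero]

theorem update_add_single (n : Fin d → ℤ) (t : Fin d) (a : ℤ) :
    Function.update (n + Pi.single t a) t 0 = Function.update n t 0 := by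
  funext i
  by_cases hi : i = t
  · subst hi; simp
  · simp [hi]

theorem IsPeriodic.update {V : (Fin d → ℤ) → ℂ} (hV : IsPeriodic q V) (t : Fin d) :
    IsPeriodic q fun n => V (Function.update n t 0) := by
  intro n j
  by_cases hj : j = t
  · subst hj
    simp only [update_add_single]
  · have : Function.update (n + Pi.single j (q j : ℤ)) t 0
        = Function.update n t 0 + Pi.single j (q j : ℤ) := by
      funext i
      by_cases hi : i = t
      · subst hi; simp [Ne.symm hj]
      · simp [hi]
    simp only [this, hV _ j]

theorem IsSeparable.fourierCoeff_eq_zero (hq : ∀ j, 0 < q j) {V : (Fin d → ℤ) → ℂ}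
    (hV : IsPeriodic q V) {s t : Fin d} (hst : s ≠ t) (h : IsSeparable V s t) {m : Fin d → ℤ}
    (hs : ¬ (q s : ℤ) ∣ m s) (ht : ¬ (q t : ℤ) ∣ m t) : fourierCoeff q V m = 0 := by
  rw [isSeparable_iff hst] at h
  have h1 := fourierCoeff_eq_zero_of_add_single hq (hV.update t)
    (fun x => by rw [update_add_single]) ht
  have hp := hV.update s
  have hp' : IsPeriodic q fun n => V (Function.update (Function.update n s 0) t 0) :=
    (hV.update t).update s
  have h2 := fourierCoeff_eq_zero_of_add_single hq hp (fun x => by rw [update_add_single]) hs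
  have h3 := fourierCoeff_eq_zero_of_add_single hq hp' (fun x => by rw [update_add_single]) hs
  have h4 : fourierCoeff q V m = fourierCoeff q (fun n => V (Function.update n t 0)) m
      + (fourierCoeff q (fun n => V (Function.update n s 0)) m
        - fourierCoeff q (fun n => V (Function.update (Function.update n s 0) t 0)) m) := by
    simp only [fourierCoeff]
    rw [← mul_sub, ← mul_add, ← Finset.sum_sub_distrib, ← Finset.sum_add_distrib]
    congr 1
    refine Finset.sum_congr rfl fun x _ => ?_
    nth_rewrite 1 [h x]
    ring
  rw [h4, h1, h2, h3]
  ring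

theorem isSeparable_of_fourierCoeff_eq_zero (hq : ∀ j, 0 < q j) {V : (Fin d → ℤ) → ℂ}
    (hV : IsPeriodic q V) {s t : Fin d} (hst : s ≠ t)
    (h : ∀ m ∈ fundamentalDomain q, ¬ (q s : ℤ) ∣ m s → ¬ (q t : ℤ) ∣ m t →
      fourierCoeff q V m = 0) : IsSeparable V s t := by
  rw [isSeparable_iff hst]
  intro n
  have hinv : ∀ n, V n = ∑ m ∈ fundamentalDomain q, fourierCoeff q V m * character q m n := by
    intro n
    have := sum_fourierCoeff_mul_character hq hV 0 n
    simp only [sub_zero] at this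
    rw [this]
    simp [character]
  rw [hinv n, hinv (Function.update n t 0), hinv (Function.update n s 0),
    hinv (Function.update _ t 0), ← Finset.sum_sub_distrib, ← Finset.sum_add_distrib]
  refine Finset.sum_congr rfl fun m hm => ?_
  have hupd : ∀ (n : Fin d → ℤ) (i : Fin d), m i = 0 →
      character q m (Function.update n i 0) = character q m n := by
    intro n i hi
    refine Finset.prod_congr rfl fun j _ => ?_
    by_cases hj : j = i
    · subst hj; simp [hi]
    · simp [hj]
  have hdvd : ∀ i, (q i : ℤ) ∣ m i → m i = 0 := fun i hi =>
    Int.eq_zero_of_dvd_of_nonneg_of_lt (mem_fundamentalDomain.1 hm i).1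
      (mem_fundamentalDomain.1 hm i).2 hi
  by_cases hs : (q s : ℤ) ∣ m s
  · rw [hupd n s (hdvd s hs), Function.update_comm hst, hupd _ s (hdvd s hs)]
    ring
  · by_cases ht : (q t : ℤ) ∣ m t
    · rw [hupd _ t (hdvd t ht), hupd _ t (hdvd t ht)]
      ring
    · rw [h m hm hs ht]
      ring

/-! ### The Floquet matrix in momentum space -/

/-- The trigonometric form `L_n(z) = ∑_j e^{2πi n_j / q_j} z_j`. -/
def symbol (q : Fin d → ℕ) (n : Fin d → ℤ) : (Fin d → ℂ) →ₗ[ℂ] ℂ :=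
  ∑ j, phase q j (n j) • LinearMap.proj j

theorem symbol_apply (n : Fin d → ℤ) (z : Fin d → ℂ) :
    symbol q n z = ∑ j, phase q j (n j) * z j := by
  simp [symbol]

/-- The matrix of the convolution by the Fourier coefficients of `V`, which represents the
multiplication by `V` in the basis of characters. -/
def potentialMatrix (q : Fin d → ℕ) (V : (Fin d → ℤ) → ℂ) :
    Matrix (fundamentalDomain q) (fundamentalDomain q) ℂ :=
  Matrix.of fun m n => fourierCoeff q V (m - n)

/-- The diagonal of the Laplacian in momentum space, for the multipliers `z_j`. -/
def kineticSymbol (q : Fin d → ℕ) (z : Fin d → ℂ) (n : Fin d → ℤ) : ℂ :=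
  symbol q n z + symbol q (-n) z⁻¹

/-- The Bloch wave `x ↦ ∏_j z_j^{x_j} e^{2πi n_j x_j / q_j}`. -/
def blochWave (q : Fin d → ℕ) (z : Fin d → ℂ) (n x : Fin d → ℤ) : ℂ :=
  (∏ j, z j ^ x j) * character q n x

theorem blochWave_add_single {z : Fin d → ℂ} (hz : ∀ j, z j ≠ 0) (n x : Fin d → ℤ) (j : Fin d)
    (a : ℤ) :
    blochWave q z n (x + Pi.single j a) = z j ^ a * phase q j (n j * a) * blochWave q z n x := by
  have h : ∏ i, z i ^ ((Pi.single j a : Fin d → ℤ) i) = z j ^ a := by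
    rw [Finset.prod_eq_single j]
    · simp
    · intro i _ hi
      simp [hi]
    · simp
  simp only [blochWave, character_add_right, character_single, Pi.add_apply,
    fun i => zpow_add₀ (hz i), Finset.prod_mul_distrib, h]
  ring

/-- Bloch waves are eigenfunctions of the Laplacian. -/
theorem schrodinger_blochWave (V : (Fin d → ℤ) → ℂ) {z : Fin d → ℂ} (hz : ∀ j, z j ≠ 0)
    (n x : Fin d → ℤ) :
    schrodinger V (blochWave q z n) x = (kineticSymbol q z n + V x) * blochWave q z n x := by
  simp only [schrodinger, laplacian, kineticSymbol, symbol_apply, add_mul, Finset.sum_mul,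
    ← Finset.sum_add_distrib]
  congr 1
  refine Finset.sum_congr rfl fun j _ => ?_
  rw [sub_eq_add_neg, ← Pi.single_neg, blochWave_add_single hz, blochWave_add_single hz]
  simp
  ring

theorem schrodinger_sum {ι : Type*} (V : (Fin d → ℤ) → ℂ) (s : Finset ι) (c : ι → ℂ)
    (f : ι → (Fin d → ℤ) → ℂ) (x : Fin d → ℤ) :
    schrodinger V (fun y => ∑ i ∈ s, f i y * c i) x = ∑ i ∈ s, schrodinger V (f i) x * c i := by
  simp only [schrodinger, laplacian, add_mul, Finset.sum_add_distrib, Finset.sum_mul,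
    Finset.mul_sum]
  congr 1
  · congr 1 <;> exact Finset.sum_comm
  · exact Finset.sum_congr rfl fun i _ => by ring

/-- A Bloch wave is recovered from its values on the fundamental domain. -/
theorem sum_floquetBasis_mul_blochWave (hq : ∀ j, 0 < q j) {k z : Fin d → ℂ}
    (hz : ∀ j, z j ≠ 0) (hzk : ∀ j, z j ^ q j = Complex.exp (2 * Real.pi * Complex.I * k j))
    (n x : Fin d → ℤ) :
    ∑ w ∈ fundamentalDomain q, floquetBasis q k w x * blochWave q z n w
      = blochWave q z n x := by
  rw [Finset.sum_eq_single_of_mem _ (emod_mem_fundamentalDomain hq x)]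
  · rw [floquetBasis, if_pos fun j => rfl, Finset.mul_sum, Complex.exp_sum, blochWave, blochWave,
      (isPeriodic_character hq n).apply_emod, ← mul_assoc, ← Finset.prod_mul_distrib]
    congr 1
    refine Finset.prod_congr rfl fun j _ => ?_
    have h : 2 * Real.pi * Complex.I * (k j * ((x j / (q j : ℤ) : ℤ) : ℂ))
        = ((x j / (q j : ℤ) : ℤ) : ℂ) * (2 * Real.pi * Complex.I * k j) := by ring
    rw [h, Complex.exp_int_mul, ← hzk, ← zpow_natCast, ← zpow_mul, ← zpow_add₀ (hz j),
      Int.mul_ediv_add_emod]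
  · intro w _ hne
    rw [floquetBasis, if_neg, zero_mul]
    exact fun h => hne (funext fun j => (h j).symm)

/-- The Floquet determinant in momentum space. -/
theorem floquetDet_eq (hq : ∀ j, 0 < q j) {V : (Fin d → ℤ) → ℂ} (hV : IsPeriodic q V)
    {k z : Fin d → ℂ} (hz : ∀ j, z j ≠ 0)
    (hzk : ∀ j, z j ^ q j = Complex.exp (2 * Real.pi * Complex.I * k j)) (μ : ℂ) :
    floquetDet q V k μ = (Matrix.diagonal (fun n : fundamentalDomain q =>
      kineticSymbol q z n - μ) + potentialMatrix q V).det := by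
  set F : Matrix (fundamentalDomain q) (fundamentalDomain q) ℂ :=
    Matrix.of fun x n => blochWave q z n x with hF
  set G : Matrix (fundamentalDomain q) (fundamentalDomain q) ℂ :=
    Matrix.of fun n x => character q (-n) x * (∏ j, z j ^ (x : Fin d → ℤ) j)⁻¹ with hG
  have hz0 : ∀ x : Fin d → ℤ, (∏ j, z j ^ x j) ≠ 0 := fun x =>
    Finset.prod_ne_zero_iff.2 fun j _ => zpow_ne_zero _ (hz j)
  have hFG : F * G = (∏ j, (q j : ℂ)) • 1 := by
    ext x y
    have h : ∀ n : Fin d → ℤ, blochWave q z n x *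
        (character q (-n) y * (∏ j, z j ^ (y : Fin d → ℤ) j)⁻¹)
        = (∏ j, z j ^ (x : Fin d → ℤ) j) * (∏ j, z j ^ (y : Fin d → ℤ) j)⁻¹ *
          character q n (x - y) := by
      intro n
      rw [sub_eq_add_neg, character_add_right, character_neg_right, blochWave]
      ring
    simp only [hF, hG, Matrix.mul_apply, Matrix.of_apply, h, Matrix.smul_apply, Matrix.one_apply,
      ← Finset.mul_sum]
    rw [Finset.sum_coe_sort (fundamentalDomain q)
      (fun n => character q n ((x : Fin d → ℤ) - (y : Fin d → ℤ))), sum_character hq]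
    have hxy : (∀ j, (q j : ℤ) ∣ ((x : Fin d → ℤ) - (y : Fin d → ℤ)) j) ↔ x = y := by
      refine (dvd_sub_iff_eq_of_mem (n := (x : Fin d → ℤ)) y.2).trans ?_
      rw [emod_of_mem_fundamentalDomain x.2, eq_comm, Subtype.ext_iff]
    simp only [hxy]
    split_ifs with h
    · subst h
      rw [mul_inv_cancel₀ (hz0 _), one_mul, smul_eq_mul, mul_one]
    · simp
  have hFdet : F.det ≠ 0 := by
    intro h0
    have h1 := congrArg Matrix.det hFG
    rw [Matrix.det_mul, h0, zero_mul, Matrix.det_smul, Matrix.det_one, mul_one] at h1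
    exact pow_ne_zero _ (prod_natCast_ne_zero hq) h1.symm
  have hDF : (floquetMatrix q V k - μ • 1) * F = F * (Matrix.diagonal
      (fun n : fundamentalDomain q => kineticSymbol q z n - μ) + potentialMatrix q V) := by
    rw [sub_mul, mul_add, Matrix.smul_mul, one_mul]
    ext x n
    have h1 : (floquetMatrix q V k * F) x n
        = (kineticSymbol q z n + V x) * blochWave q z n x := by
      rw [← schrodinger_blochWave V hz]
      have h2 : blochWave q z n = fun y => ∑ w ∈ fundamentalDomain q,
          floquetBasis q k w y * blochWave q z n w := by
        funext y
        rw [sum_floquetBasis_mul_blochWave hq hz hzk]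
      rw [h2, schrodinger_sum]
      simp only [Matrix.mul_apply, floquetMatrix, hF, Matrix.of_apply]
      exact Finset.sum_coe_sort (fundamentalDomain q)
        (fun w => schrodinger V (floquetBasis q k w) x * blochWave q z n w)
    have h3 : (F * potentialMatrix q V) x n = V x * blochWave q z n x := by
      have h4 := sum_fourierCoeff_mul_character hq hV n x
      simp only [Matrix.mul_apply, potentialMatrix, hF, Matrix.of_apply, blochWave, mul_assoc,
        ← Finset.mul_sum]
      rw [Finset.sum_coe_sort (fundamentalDomain q) (fun m => character q m
        (x : Fin d → ℤ) * fourierCoeff q V (m - (n : Fin d → ℤ)))]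
      simp only [mul_comm (character q _ _)]
      rw [h4]
      ring
    rw [Matrix.sub_apply, Matrix.add_apply, h1, h3, Matrix.mul_diagonal, Matrix.smul_apply]
    simp only [hF, Matrix.of_apply, smul_eq_mul]
    ring
  have h := congrArg Matrix.det hDF
  rw [Matrix.det_mul, Matrix.det_mul, mul_comm] at h
  exact mul_left_cancel₀ hFdet h

/-! ### Complex quasimomenta -/

theorem differentiable_floquetDet (q : Fin d → ℕ) (V : (Fin d → ℤ) → ℂ) (μ : ℂ) :
    Differentiable ℂ fun k => floquetDet q V k μ := by
  have hb : ∀ w m : Fin d → ℤ, Differentiable ℂ fun k => floquetBasis q k w m := by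
    intro w m
    by_cases h : ∀ j, m j % (q j : ℤ) = w j
    · simp only [floquetBasis, if_pos h]
      fun_prop
    · simp only [floquetBasis, if_neg h]
      fun_prop
  have hs : ∀ w m : Fin d → ℤ, Differentiable ℂ fun k => schrodinger V (floquetBasis q k w) m := by
    intro w m
    simp only [schrodinger, laplacian]
    have := hb w
    fun_prop
  simp only [floquetDet, Matrix.det_apply, floquetMatrix, Matrix.sub_apply, Matrix.of_apply]
  refine Differentiable.fun_sum fun σ _ => ?_
  simp only [Units.smul_def, zsmul_eq_mul]
  have := hs
  fun_prop

/-- An entire function of several variables that vanishes at all real points with prescribed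
coordinates outside `S` vanishes at all complex points with these coordinates outside `S`. -/
theorem eq_zero_of_forall_real {f : (Fin d → ℂ) → ℂ} (hf : Differentiable ℂ f)
    (S : Finset (Fin d)) (κ : Fin d → ℝ)
    (h : ∀ k : Fin d → ℝ, (∀ j, j ∉ S → k j = κ j) → f (fun j => (k j : ℂ)) = 0)
    (k : Fin d → ℂ) (hk : ∀ j, j ∉ S → k j = κ j) : f k = 0 := by
  -- The coordinates in `A` are freed one at a time by the identity theorem in one variable.
  have key : ∀ A : Finset (Fin d), A ⊆ S → ∀ k : Fin d → ℂ,
      (∀ j, j ∉ S → k j = κ j) → (∀ j, j ∉ A → (k j).im = 0) → f k = 0 := by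
    intro A
    induction A using Finset.induction_on with
    | empty =>
      intro _ k hk him
      have h1 : k = fun j => (((k j).re : ℝ) : ℂ) :=
        funext fun j => Complex.ext (by simp) (by simp [him j])
      rw [h1]
      exact h _ fun j hj => by rw [hk j hj, Complex.ofReal_re]
    | insert a A ha ih =>
      intro hA k hk him
      have haS : a ∈ S := hA (Finset.mem_insert_self a A)
      have hg : Differentiable ℂ fun w : ℂ => f (Function.update k a w) := by
        refine hf.comp (differentiable_pi.2 fun i => ?_)
        by_cases hi : i = a
        · subst hi
          simp
        · simp [hi]
      have hreal : ∀ x : ℝ, f (Function.update k a (x : ℂ)) = 0 := by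
        intro x
        refine ih (fun i hi => hA (Finset.mem_insert_of_mem hi)) _ (fun j hj => ?_) fun j hj => ?_
        · rw [Function.update_of_ne (fun hja : j = a => hj (hja.symm ▸ haS)), hk j hj]
        · by_cases hja : j = a
          · subst hja
            simp
          · rw [Function.update_of_ne hja]
            exact him j (by simp [hja, hj])
      have hfreq : ∃ᶠ w in nhdsWithin (0 : ℂ) {0}ᶜ, f (Function.update k a w) = 0 := by
        have ht : Filter.Tendsto (fun n : ℕ => ((1 / ((n : ℝ) + 1) : ℝ) : ℂ)) Filter.atTop
            (nhdsWithin (0 : ℂ) {0}ᶜ) := by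
          refine tendsto_nhdsWithin_iff.2 ⟨?_, Filter.Eventually.of_forall fun n => ?_⟩
          · have := (Complex.continuous_ofReal.tendsto 0).comp
              (tendsto_one_div_add_atTop_nhds_zero_nat (𝕜 := ℝ))
            rwa [Complex.ofReal_zero] at this
          · have : (1 / ((n : ℝ) + 1)) ≠ 0 := by positivity
            exact Complex.ofReal_ne_zero.2 this
        exact ht.frequently (Filter.Frequently.of_forall fun n => hreal _)
      have han := hg.differentiableOn.analyticOnNhd isOpen_univ
      have hz := han.eqOn_zero_of_preconnected_of_frequently_eq_zero isPreconnected_univ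
        (Set.mem_univ 0) hfreq (Set.mem_univ (k a))
      simpa using hz
  exact key S subset_rfl k hk fun j hj => by rw [hk j hj, Complex.ofReal_im]

/-- Partial isospectrality in momentum space, for arbitrary non-zero complex multipliers in the
directions of `S`. -/
theorem GenPartiallyFermiIsospectral.exists_det_eq (hq : ∀ j, 0 < q j) {V Y : (Fin d → ℤ) → ℂ}
    (hV : IsPeriodic q V) (hY : IsPeriodic q Y) {S : Finset (Fin d)}
    (h : GenPartiallyFermiIsospectral q V Y S) :
    ∃ (μ₁ μ₂ : ℂ) (ζ : Fin d → ℂ), (∀ j, ζ j ≠ 0) ∧ ∀ z : Fin d → ℂ, (∀ j, z j ≠ 0) →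
      (∀ j, j ∉ S → z j = ζ j) →
      (Matrix.diagonal (fun n : fundamentalDomain q => kineticSymbol q z n - μ₁)
        + potentialMatrix q V).det
      = (Matrix.diagonal (fun n : fundamentalDomain q => kineticSymbol q z n - μ₂)
        + potentialMatrix q Y).det := by
  obtain ⟨-, μ₁, μ₂, κ, hκ⟩ := h
  have hq0 : ∀ j, (q j : ℂ) ≠ 0 := fun j => by exact_mod_cast (hq j).ne'
  have hpow : ∀ (j : Fin d) (a : ℂ), Complex.exp (2 * Real.pi * Complex.I * a / q j) ^ q j
      = Complex.exp (2 * Real.pi * Complex.I * a) := by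
    intro j a
    rw [← Complex.exp_nat_mul]
    congr 1
    have := hq0 j
    field_simp
  refine ⟨μ₁, μ₂, fun j => Complex.exp (2 * Real.pi * Complex.I * κ j / q j),
    fun j => Complex.exp_ne_zero _, fun z hz hzS => ?_⟩
  have hk : ∀ j, ∃ a : ℂ, z j ^ q j = Complex.exp (2 * Real.pi * Complex.I * a)
      ∧ (j ∉ S → a = κ j) := by
    intro j
    by_cases hj : j ∈ S
    · refine ⟨q j * Complex.log (z j) / (2 * Real.pi * Complex.I), ?_, fun h => absurd hj h⟩
      rw [mul_div_cancel₀ _ Complex.two_pi_I_ne_zero, Complex.exp_nat_mul, Complex.exp_log (hz j)]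
    · exact ⟨κ j, by rw [hzS j hj, hpow], fun _ => rfl⟩
  choose k hzk hkS using hk
  rw [← floquetDet_eq hq hV hz hzk, ← floquetDet_eq hq hY hz hzk, ← sub_eq_zero]
  refine eq_zero_of_forall_real (f := fun k => floquetDet q V k μ₁ - floquetDet q Y k μ₂)
    ((differentiable_floquetDet q V μ₁).sub (differentiable_floquetDet q Y μ₂)) S κ
    (fun k hk => sub_eq_zero.2 (hκ k hk)) k hkS

/-! ### Determinants with a large diagonal part -/

section LinearAlgebra

variable {ι : Type*} [Fintype ι] [DecidableEq ι]

/-- If the diagonal part of a matrix grows linearly on the rows outside `p` and the rest converges,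
the determinant, divided by the powers of the large parameter, tends to the determinant of the
limit on the block `p`, times the product of the growth rates. -/
theorem tendsto_det_diagonal_add (p : ι → Prop) [DecidablePred p] (a : ι → ℂ)
    (ha : ∀ i, p i → a i = 0) {M : ℕ → Matrix ι ι ℂ} {N : Matrix ι ι ℂ}
    (hM : Filter.Tendsto M Filter.atTop (nhds N)) :
    Filter.Tendsto (fun T : ℕ => (∏ i, if p i then 1 else (T : ℂ)⁻¹) *
        (Matrix.diagonal (fun i => T * a i) + M T).det) Filter.atTop
      (nhds ((N.toSquareBlockProp p).det * ∏ i : {i // ¬ p i}, a i)) := by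
  have hdet : (N.toSquareBlockProp p).det * ∏ i : {i // ¬ p i}, a i
      = (Matrix.of fun i j => if p i then N i j else Matrix.diagonal a i j).det := by
    rw [Matrix.twoBlockTriangular_det _ p]
    · congr 1
      · congr 1
        ext i j
        simp [Matrix.toSquareBlockProp_def, i.2]
      · rw [← Matrix.det_diagonal]
        congr 1
        ext i j
        simp [Matrix.toSquareBlockProp_def, i.2, Matrix.diagonal_apply, Subtype.ext_iff]
    · intro i hi j hj
      have hij : i ≠ j := fun h => hi (h ▸ hj)
      simp [hi, hij]
  simp only [hdet, ← Matrix.det_mul_column]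
  refine ((continuous_id.matrix_det).tendsto _).comp ?_
  refine tendsto_pi_nhds.2 fun i => tendsto_pi_nhds.2 fun j => ?_
  have hMij : Filter.Tendsto (fun T => M T i j) Filter.atTop (nhds (N i j)) :=
    (tendsto_pi_nhds.1 (tendsto_pi_nhds.1 hM i) j)
  by_cases hi : p i
  · refine (hMij.congr fun T => ?_).trans (by simp [hi])
    by_cases hij : i = j
    · subst hij
      simp [hi, ha i hi]
    · simp [hi, hij]
  · have hinv : Filter.Tendsto (fun T : ℕ => (T : ℂ)⁻¹) Filter.atTop (nhds 0) :=
      tendsto_inv_atTop_nhds_zero_nat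
    have h1 : Filter.Tendsto (fun T : ℕ => Matrix.diagonal a i j + (T : ℂ)⁻¹ * M T i j)
        Filter.atTop (nhds (Matrix.diagonal a i j + 0 * N i j)) :=
      (hinv.mul hMij).const_add _
    simp only [zero_mul, add_zero] at h1
    simp only [Matrix.of_apply, if_neg hi]
    refine h1.congr' ?_
    filter_upwards [Filter.eventually_gt_atTop 0] with T hT
    have hT' : (T : ℂ) ≠ 0 := by exact_mod_cast hT.ne'
    by_cases hij : i = j
    · subst hij
      simp only [Matrix.diagonal_apply_eq, Matrix.add_apply]
      field_simp
    · simp [hij]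

/-- Two matrices with the same characteristic polynomial have squares of the same trace. -/
theorem trace_mul_self_eq_of_charpoly_eq {A B : Matrix ι ι ℂ} (h : A.charpoly = B.charpoly) :
    (A * A).trace = (B * B).trace := by
  cases isEmpty_or_nonempty ι
  · simp [Matrix.trace]
  -- `charpoly (A ^ 2)` at `x ^ 2` is `± charpoly A` at `x` times `charpoly A` at `-x`.
  have key : ∀ (A : Matrix ι ι ℂ) (x : ℂ), (A * A).charpoly.eval (x ^ 2)
      = (-1) ^ Fintype.card ι * (A.charpoly.eval x * A.charpoly.eval (-x)) := by
    intro A x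
    simp only [Matrix.eval_charpoly]
    rw [mul_left_comm, ← Matrix.det_neg, ← Matrix.det_mul]
    congr 1
    have h1 : Matrix.scalar ι (x ^ 2) = Matrix.scalar ι x * Matrix.scalar ι x := by
      rw [← map_mul, sq]
    have h2 : A * Matrix.scalar ι x = Matrix.scalar ι x * A :=
      (Matrix.scalar_commute x (fun r => mul_comm _ _) A).symm
    rw [h1, map_neg, neg_sub, sub_neg_eq_add, sub_mul, mul_add, mul_add, h2]
    abel
  have hcp : (A * A).charpoly = (B * B).charpoly := by
    refine Polynomial.funext fun y => ?_
    obtain ⟨x, rfl⟩ := IsAlgClosed.exists_pow_nat_eq y (n := 2) (by norm_num)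
    rw [key, key, h]
  rw [Matrix.trace_eq_neg_charpoly_coeff, Matrix.trace_eq_neg_charpoly_coeff, hcp]

/-- If the pencils `x C + A` and `x C + B`, with `C` diagonal with entries `±1`, have the same
determinants, then `C A` and `C B` have squares of the same trace. -/
theorem sum_mul_mul_eq_of_det_pencil_eq {A B : Matrix ι ι ℂ} {c : ι → ℂ} (hc : ∀ i, c i ^ 2 = 1)
    (h : ∀ x : ℂ, (Matrix.diagonal (fun i => x * c i) + A).det
      = (Matrix.diagonal (fun i => x * c i) + B).det) :
    ∑ i, ∑ j, c i * c j * (A i j * A j i) = ∑ i, ∑ j, c i * c j * (B i j * B j i) := by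
  have hdet : ∀ (A : Matrix ι ι ℂ) (x : ℂ), (-(Matrix.diagonal c * A)).charpoly.eval x
      = (Matrix.diagonal c).det * (Matrix.diagonal (fun i => x * c i) + A).det := by
    intro A x
    rw [Matrix.eval_charpoly, ← Matrix.det_mul, mul_add, Matrix.diagonal_mul_diagonal,
      sub_neg_eq_add]
    congr 2
    rw [Matrix.scalar_apply]
    congr 1
    funext i
    linear_combination (-x) * hc i
  have hcp : (-(Matrix.diagonal c * A)).charpoly = (-(Matrix.diagonal c * B)).charpoly :=
    Polynomial.funext fun x => by rw [hdet, hdet, h]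
  have htr : ∀ A : Matrix ι ι ℂ, (-(Matrix.diagonal c * A) * -(Matrix.diagonal c * A)).trace
      = ∑ i, ∑ j, c i * c j * (A i j * A j i) := by
    intro A
    simp only [Matrix.trace, Matrix.diag_apply, neg_mul_neg, Matrix.mul_apply (N := _ * A),
      Matrix.diagonal_mul]
    exact Finset.sum_congr rfl fun i _ => Finset.sum_congr rfl fun j _ => by ring
  rw [← htr, ← htr]
  exact trace_mul_self_eq_of_charpoly_eq hcp

end LinearAlgebra

/-! ### Roots of unity on the unit circle -/

/-- If an affine map of the complex plane sends three distinct points `p`, `p'`, `p''` of the unit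
circle to points `σ`, `σ'`, `σ''` of the unit circle, then it is constant or a rotation about the
origin. That the points correspond by an affine map is expressed by a vanishing determinant, and
membership in the unit circle by the conjugate of that relation. -/
theorem eq_or_eq_of_affine_circle {p p' p'' σ σ' σ'' : ℂ} (hp : p ≠ 0) (hp' : p' ≠ 0)
    (hp'' : p'' ≠ 0) (hσ : σ ≠ 0) (hσ' : σ' ≠ 0) (hσ'' : σ'' ≠ 0)
    (h1 : p ≠ p') (h2 : p' ≠ p'') (h3 : p ≠ p'')
    (h : σ * (p' - p'') + σ' * (p'' - p) + σ'' * (p - p') = 0)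
    (hconj : σ⁻¹ * (p'⁻¹ - p''⁻¹) + σ'⁻¹ * (p''⁻¹ - p⁻¹) + σ''⁻¹ * (p⁻¹ - p'⁻¹) = 0) :
    (σ = σ' ∧ σ = σ'') ∨ (σ / p = σ' / p' ∧ σ / p = σ'' / p'') := by
  -- `σ = x + y p` and `τ = p / σ = x' + y' p` at the three points, and then `y y' = 0` because a
  -- quadratic polynomial with three roots vanishes.
  have e1 : p - p' ≠ 0 := sub_ne_zero.2 h1
  have e2 : p' - p'' ≠ 0 := sub_ne_zero.2 h2
  have e3 : p - p'' ≠ 0 := sub_ne_zero.2 h3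
  obtain ⟨y, hy⟩ : ∃ y, y = (σ - σ') / (p - p') := ⟨_, rfl⟩
  obtain ⟨τ, hτ⟩ : ∃ τ, τ = p / σ := ⟨_, rfl⟩
  obtain ⟨τ', hτ'⟩ : ∃ τ', τ' = p' / σ' := ⟨_, rfl⟩
  obtain ⟨τ'', hτ''⟩ : ∃ τ'', τ'' = p'' / σ'' := ⟨_, rfl⟩
  obtain ⟨y', hy'⟩ : ∃ y', y' = (τ - τ') / (p - p') := ⟨_, rfl⟩
  have m : σ * τ = p := by rw [hτ]; field_simp
  have m' : σ' * τ' = p' := by rw [hτ']; field_simp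
  have m'' : σ'' * τ'' = p'' := by rw [hτ'']; field_simp
  have hτrel : τ * (p' - p'') + τ' * (p'' - p) + τ'' * (p - p') = 0 := by
    have : τ * (p' - p'') + τ' * (p'' - p) + τ'' * (p - p') = -(p * p' * p'') *
        (σ⁻¹ * (p'⁻¹ - p''⁻¹) + σ'⁻¹ * (p''⁻¹ - p⁻¹) + σ''⁻¹ * (p⁻¹ - p'⁻¹)) := by
      rw [hτ, hτ', hτ'']
      field_simp
      ring
    rw [this, hconj, mul_zero]
  have a1 : σ - σ' = y * (p - p') := by rw [hy]; field_simp
  have b1 : τ - τ' = y' * (p - p') := by rw [hy']; field_simp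
  have a2 : σ - σ'' = y * (p - p'') := by
    refine mul_left_cancel₀ e1 ?_
    linear_combination (-1) * h + (p - p'') * a1
  have b2 : τ - τ'' = y' * (p - p'') := by
    refine mul_left_cancel₀ e1 ?_
    linear_combination (-1) * hτrel + (p - p'') * b1
  have hyy : y * y' = 0 := by
    have c1 : σ * y' + τ * y - y * y' * (p - p') = 1 := by
      refine mul_left_cancel₀ e1 ?_
      linear_combination m - m' - τ' * a1 - σ * b1 + y * (p - p') * b1
    have c2 : σ * y' + τ * y - y * y' * (p - p'') = 1 := by
      refine mul_left_cancel₀ e3 ?_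
      linear_combination m - m'' - τ'' * a2 - σ * b2 + y * (p - p'') * b2
    refine mul_left_cancel₀ e2 ?_
    linear_combination c1 - c2
  rcases mul_eq_zero.1 hyy with h0 | h0
  · left
    rw [h0, zero_mul] at a1 a2
    exact ⟨sub_eq_zero.1 a1, sub_eq_zero.1 a2⟩
  · right
    rw [h0, zero_mul, sub_eq_zero] at b1 b2
    have k : ∀ {a b c : ℂ}, a ≠ 0 → b ≠ 0 → c = b / a → a / b = c⁻¹ := by
      rintro a b _ _ _ rfl
      rw [inv_div]
    rw [k hσ hp hτ, k hσ' hp' hτ', k hσ'' hp'' hτ'', ← b1, ← b2]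
    exact ⟨rfl, rfl⟩

theorem symbol_single (n : Fin d → ℤ) (j : Fin d) (a : ℂ) :
    symbol q n (Pi.single j a) = phase q j (n j) * a := by
  rw [symbol_apply, Finset.sum_eq_single j]
  · simp
  · intro i _ hi
    simp [hi]
  · simp

theorem symbol_congr {S : Finset (Fin d)} {n m : Fin d → ℤ} (h : ∀ j ∈ S, n j = m j)
    {w : Fin d → ℂ} (hw : ∀ j, j ∉ S → w j = 0) : symbol q n w = symbol q m w := by
  rw [symbol_apply, symbol_apply]
  refine Finset.sum_congr rfl fun j _ => ?_
  by_cases hj : j ∈ S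
  · rw [h j hj]
  · rw [hw j hj, mul_zero, mul_zero]

theorem phase_ne_phase (hq : ∀ j, 0 < q j)
    (hcop : Pairwise fun i j => Nat.Coprime (q i) (q j)) {i j : Fin d} (hij : i ≠ j) {a b : ℤ}
    (ha : ¬ (q i : ℤ) ∣ a) :
    phase q i a ≠ phase q j b := fun h =>
  ha ((phase_eq_one_iff hq i a).1 (phase_eq_one_of_eq hq hcop hij h))

/-! ### Directions at infinity -/

/-- The vector supported on the coordinates `j`, `s`, `t` that spans, among such vectors, the common
kernel of the forms `L_0` and `L_l`; its entries are a cross product. -/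
def kernelVector (q : Fin d → ℕ) (l : Fin d → ℤ) (j s t : Fin d) : Fin d → ℂ :=
  Pi.single j (phase q s (l s) - phase q t (l t)) + Pi.single s (phase q t (l t) - phase q j (l j))
    + Pi.single t (phase q j (l j) - phase q s (l s))

theorem symbol_kernelVector (l n : Fin d → ℤ) (j s t : Fin d) :
    symbol q n (kernelVector q l j s t)
      = phase q j (n j) * (phase q s (l s) - phase q t (l t))
        + phase q s (n s) * (phase q t (l t) - phase q j (l j))
        + phase q t (n t) * (phase q j (l j) - phase q s (l s)) := by
  simp only [kernelVector, map_add, symbol_single]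

/-- A form `L_n` that vanishes at a kernel vector of `L_0` and `L_l` agrees with one of them in the
three coordinates involved. -/
theorem dvd_of_symbol_kernelVector_eq_zero (hq : ∀ j, 0 < q j)
    (hcop : Pairwise fun i j => Nat.Coprime (q i) (q j)) {l n : Fin d → ℤ} {j s t : Fin d}
    (hjs : j ≠ s) (hjt : j ≠ t) (hst : s ≠ t) (hs : ¬ (q s : ℤ) ∣ l s) (ht : ¬ (q t : ℤ) ∣ l t)
    (h : symbol q n (kernelVector q l j s t) = 0) :
    ((q s : ℤ) ∣ n s ∧ (q j : ℤ) ∣ n j ∧ (q t : ℤ) ∣ n t) ∨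
      ((q s : ℤ) ∣ n s - l s ∧ (q j : ℤ) ∣ n j - l j ∧ (q t : ℤ) ∣ n t - l t) := by
  rw [symbol_kernelVector] at h
  have hc := congrArg (starRingEnd ℂ) h
  simp only [map_add, map_mul, map_sub, conj_phase, phase_neg, map_zero] at hc
  have all : ∀ a b c : ℤ, phase q j a = phase q s b → phase q j a = phase q t c →
      (q s : ℤ) ∣ b ∧ (q j : ℤ) ∣ a ∧ (q t : ℤ) ∣ c := by
    intro a b c h1 h2
    have h3 := phase_eq_one_of_eq hq hcop hjs h1
    exact ⟨(phase_eq_one_iff hq _ _).1 (h1 ▸ h3), (phase_eq_one_iff hq _ _).1 h3,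
      (phase_eq_one_iff hq _ _).1 (h2 ▸ h3)⟩
  have hdiv : ∀ i : Fin d, phase q i (n i) / phase q i (l i) = phase q i (n i - l i) := by
    intro i
    rw [sub_eq_add_neg, phase_add, phase_neg, div_eq_mul_inv]
  rcases eq_or_eq_of_affine_circle (phase_ne_zero j (l j)) (phase_ne_zero s (l s))
    (phase_ne_zero t (l t)) (phase_ne_zero j (n j)) (phase_ne_zero s (n s)) (phase_ne_zero t (n t))
    (phase_ne_phase hq hcop hjs.symm hs).symm (phase_ne_phase hq hcop hst hs)
    (phase_ne_phase hq hcop hjt.symm ht).symm h hc with ⟨h1, h2⟩ | ⟨h1, h2⟩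
  · exact Or.inl (all _ _ _ h1 h2)
  · rw [hdiv, hdiv] at h1 h2
    exact Or.inr (all _ _ _ h1 h2)

theorem eq_of_mem_of_dvd_sub {n l : Fin d → ℤ} (hn : n ∈ fundamentalDomain q)
    (hl : l ∈ fundamentalDomain q) {j : Fin d} (h : (q j : ℤ) ∣ n j - l j) : n j = l j := by
  have h1 := congrFun (emod_of_mem_fundamentalDomain hn) j
  have h2 := congrFun (emod_of_mem_fundamentalDomain hl) j
  rw [← h1, ← h2]
  exact ((Int.modEq_iff_dvd).2 h).symm

theorem zero_mem_fundamentalDomain (hq : ∀ j, 0 < q j) : 0 ∈ fundamentalDomain q :=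
  mem_fundamentalDomain.2 fun j => ⟨le_rfl, Int.natCast_pos.2 (hq j)⟩

/-- A direction `w` in which exactly those forms `L_n` vanish that agree on `S` with `L_0` or
`L_l`. -/
theorem exists_direction (hq : ∀ j, 0 < q j)
    (hcop : Pairwise fun i j => Nat.Coprime (q i) (q j)) {S : Finset (Fin d)} (hS : 3 ≤ S.card)
    {s t : Fin d} (hsS : s ∈ S) (htS : t ∈ S) (hst : s ≠ t) {l : Fin d → ℤ}
    (hl : l ∈ fundamentalDomain q) (hs : ¬ (q s : ℤ) ∣ l s) (ht : ¬ (q t : ℤ) ∣ l t) :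
    ∃ w : Fin d → ℂ, (∀ j, j ∉ S → w j = 0) ∧ (∀ j ∈ S, w j ≠ 0) ∧
      ∀ n ∈ fundamentalDomain q,
        symbol q n w = 0 ↔ (∀ j ∈ S, n j = 0) ∨ ∀ j ∈ S, n j = l j := by
  obtain ⟨r, hrS, hrs, hrt⟩ : ∃ r ∈ S, r ≠ s ∧ r ≠ t := by
    obtain ⟨r, hr, hr'⟩ := Finset.exists_mem_notMem_of_card_lt_card
      (s := {s, t}) (t := S) (lt_of_le_of_lt Finset.card_le_two hS)
    simp only [Finset.mem_insert, Finset.mem_singleton, not_or] at hr'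
    exact ⟨r, hr, hr'⟩
  let K : Submodule ℂ (Fin d → ℂ) := LinearMap.ker (symbol q 0) ⊓ LinearMap.ker (symbol q l) ⊓
    ⨅ j ∈ Sᶜ, LinearMap.ker (LinearMap.proj j)
  have hK : ∀ w, w ∈ K ↔ (symbol q 0 w = 0 ∧ symbol q l w = 0) ∧ ∀ j, j ∉ S → w j = 0 := by
    intro w
    simp [K, Submodule.mem_inf, Submodule.mem_iInf]
  have hvK : ∀ j ∈ S, kernelVector q l j s t ∈ K := by
    intro j hj
    rw [hK, symbol_kernelVector, symbol_kernelVector]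
    refine ⟨⟨?_, by ring⟩, fun i hi => ?_⟩
    · simp
    · have h1 : i ≠ j := fun h => hi (h ▸ hj)
      have h2 : i ≠ s := fun h => hi (h ▸ hsS)
      have h3 : i ≠ t := fun h => hi (h ▸ htS)
      simp [kernelVector, h1, h2, h3]
  let p : (Fin d → ℤ) → Prop := fun n => (∀ j ∈ S, n j = 0) ∨ ∀ j ∈ S, n j = l j
  let f : {n : fundamentalDomain q // ¬ p n} ⊕ S → Module.Dual ℂ (Fin d → ℂ) :=
    Sum.elim (fun n => symbol q n.1) fun j => LinearMap.proj j.1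
  obtain ⟨w, hwK, hw⟩ := Module.Dual.exists_forall_mem_ne_zero_of_forall_exists K f (by
    rintro (⟨⟨n, hn⟩, hpn⟩ | ⟨j, hj⟩)
    · by_contra! hcon
      have hdvd : ∀ j ∈ S, j ≠ s → j ≠ t → (n s = 0 ∧ n j = 0 ∧ n t = 0) ∨
          (n s = l s ∧ n j = l j ∧ n t = l t) := by
        intro j hj hjs hjt
        have h0 := zero_mem_fundamentalDomain hq
        rcases dvd_of_symbol_kernelVector_eq_zero hq hcop hjs hjt hst hs ht
          (hcon _ (hvK j hj)) with ⟨h1, h2, h3⟩ | ⟨h1, h2, h3⟩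
        · exact Or.inl ⟨eq_of_mem_of_dvd_sub hn h0 (by simpa using h1),
            eq_of_mem_of_dvd_sub hn h0 (by simpa using h2),
            eq_of_mem_of_dvd_sub hn h0 (by simpa using h3)⟩
        · exact Or.inr ⟨eq_of_mem_of_dvd_sub hn hl h1, eq_of_mem_of_dvd_sub hn hl h2,
            eq_of_mem_of_dvd_sub hn hl h3⟩
      have hls : l s ≠ 0 := fun h => hs (h ▸ dvd_zero _)
      refine hpn ?_
      rcases hdvd r hrS hrs hrt with ⟨h1, -, h3⟩ | ⟨h1, -, h3⟩
      · left
        intro j hj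
        by_cases hjs : j = s
        · exact hjs ▸ h1
        by_cases hjt : j = t
        · exact hjt ▸ h3
        rcases hdvd j hj hjs hjt with ⟨-, h, -⟩ | ⟨h, -, -⟩
        · exact h
        · exact absurd (h.symm.trans h1) hls
      · right
        intro j hj
        by_cases hjs : j = s
        · exact hjs ▸ h1
        by_cases hjt : j = t
        · exact hjt ▸ h3
        rcases hdvd j hj hjs hjt with ⟨h, -, -⟩ | ⟨-, h, -⟩
        · exact absurd (h1.symm.trans h) hls
        · exact h
    · have hsub : ∀ {i k : Fin d} {a b : ℤ}, i ≠ k → ¬ (q i : ℤ) ∣ a →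
          phase q i a - phase q k b ≠ 0 ∧ phase q k b - phase q i a ≠ 0 := fun hik ha =>
        ⟨sub_ne_zero.2 (phase_ne_phase hq hcop hik ha),
          sub_ne_zero.2 (phase_ne_phase hq hcop hik ha).symm⟩
      by_cases hjs : j = s
      · refine ⟨_, hvK r hrS, ?_⟩
        subst hjs
        simpa [f, kernelVector, hrs.symm, hst] using (hsub hrt.symm ht).1
      by_cases hjt : j = t
      · refine ⟨_, hvK r hrS, ?_⟩
        subst hjt
        simpa [f, kernelVector, hrt.symm, hst.symm] using (hsub hrs.symm hs).2
      · refine ⟨_, hvK j hj, ?_⟩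
        simpa [f, kernelVector, hjs, hjt] using (hsub hst hs).1)
  obtain ⟨⟨hw0, hwl⟩, hwS⟩ := (hK w).1 hwK
  refine ⟨w, hwS, fun j hj => hw (Sum.inr ⟨j, hj⟩), fun n hn => ⟨fun h => ?_, ?_⟩⟩
  · by_contra hpn
    exact hw (Sum.inl ⟨⟨n, hn⟩, hpn⟩) h
  · rintro (h | h)
    · rw [symbol_congr (m := 0) h hwS, hw0]
    · rw [symbol_congr h hwS, hwl]

/-- A vector supported on `{s, t}` at which `L_0` and `L_l` take the values `1` and `c`. -/
theorem exists_symbol_eq {s t : Fin d} {l : Fin d → ℤ}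
    (h : phase q s (l s) ≠ phase q t (l t)) {S : Finset (Fin d)} (hsS : s ∈ S) (htS : t ∈ S)
    (c : ℂ) :
    ∃ u : Fin d → ℂ, (∀ j, j ∉ S → u j = 0) ∧ symbol q 0 u = 1 ∧ symbol q l u = c := by
  have h0 : phase q s (l s) - phase q t (l t) ≠ 0 := sub_ne_zero.2 h
  refine ⟨Pi.single s ((c - phase q t (l t)) / (phase q s (l s) - phase q t (l t)))
    + Pi.single t ((phase q s (l s) - c) / (phase q s (l s) - phase q t (l t))),
    fun j hj => ?_, ?_, ?_⟩
  · have h2 : j ≠ s := fun h => hj (h ▸ hsS)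
    have h3 : j ≠ t := fun h => hj (h ▸ htS)
    simp [h2, h3]
  · simp only [map_add, symbol_single, Pi.zero_apply, phase_zero]
    field_simp
    ring
  · simp only [map_add, symbol_single]
    field_simp
    ring

/-- Along the path `z = T w + x u + ζ`, with `w`, `u` supported on `S` and `ζ` outside `S`, the
momentum space matrix is `T` times a diagonal matrix plus a convergent matrix. -/
theorem tendsto_det_along_path {S : Finset (Fin d)} {w u ζ : Fin d → ℂ}
    (hwS : ∀ j, j ∉ S → w j = 0) (hw : ∀ j ∈ S, w j ≠ 0) (huS : ∀ j, j ∉ S → u j = 0)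
    (hζS : ∀ j ∈ S, ζ j = 0) (V : (Fin d → ℤ) → ℂ) (μ x : ℂ)
    (p : fundamentalDomain q → Prop) [DecidablePred p]
    (hp : ∀ n : fundamentalDomain q, p n → symbol q n w = 0) :
    Filter.Tendsto (fun T : ℕ => (∏ i, if p i then 1 else (T : ℂ)⁻¹) *
      (Matrix.diagonal (fun n : fundamentalDomain q =>
        kineticSymbol q ((T : ℂ) • w + x • u + ζ) n - μ) + potentialMatrix q V).det) Filter.atTop
      (nhds ((Matrix.diagonal (fun n : {n // p n} => x * symbol q n.1 u) +
        (Matrix.diagonal (fun n : fundamentalDomain q => kineticSymbol q ζ n - μ)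
          + potentialMatrix q V).toSquareBlockProp p).det
        * ∏ n : {n // ¬ p n}, symbol q n.1 w)) := by
  have hcoord : ∀ j, Filter.Tendsto
      (fun T : ℕ => ((T : ℂ) • w + x • u + ζ)⁻¹ j) Filter.atTop (nhds (ζ⁻¹ j)) := by
    intro j
    by_cases hj : j ∈ S
    · have h1 : Filter.Tendsto (fun T : ℕ => (T : ℂ)⁻¹ * (x * u j)) Filter.atTop
          (nhds (0 * (x * u j))) := tendsto_inv_atTop_nhds_zero_nat.mul_const _
      have h2 := (h1.const_add (w j)).inv₀ (by simpa using hw j hj)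
      have h3 := (tendsto_inv_atTop_nhds_zero_nat (𝕜 := ℂ)).mul h2
      simp only [zero_mul] at h3
      simp only [Pi.inv_apply, hζS j hj, inv_zero]
      refine h3.congr' ?_
      filter_upwards [Filter.eventually_gt_atTop 0] with T hT
      have hT' : (T : ℂ) ≠ 0 := by exact_mod_cast hT.ne'
      rw [← mul_inv, mul_add, mul_inv_cancel_left₀ hT']
      simp [hζS j hj]
    · simp [hwS j hj, huS j hj]
  have hM : Filter.Tendsto (fun T : ℕ => Matrix.diagonal (fun n : fundamentalDomain q =>
      x * symbol q n u + (symbol q n ζ + symbol q (-n) ((T : ℂ) • w + x • u + ζ)⁻¹ - μ))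
        + potentialMatrix q V) Filter.atTop
      (nhds (Matrix.diagonal (fun n : fundamentalDomain q =>
        x * symbol q n u + (kineticSymbol q ζ n - μ)) + potentialMatrix q V)) := by
    refine Filter.Tendsto.add_const _ ?_
    refine (Continuous.tendsto (f := fun v : fundamentalDomain q → ℂ => Matrix.diagonal v)
      (continuous_id.matrix_diagonal) _).comp (tendsto_pi_nhds.2 fun n => ?_)
    refine ((Filter.Tendsto.const_add _ ?_).sub_const μ).const_add _
    simp only [symbol_apply]
    exact tendsto_finsetSum _ fun j _ => (hcoord j).const_mul _
  have h := tendsto_det_diagonal_add p (fun n : fundamentalDomain q => symbol q n w) hp hM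
  have hpath : ∀ T : ℕ, Matrix.diagonal (fun n : fundamentalDomain q =>
        kineticSymbol q ((T : ℂ) • w + x • u + ζ) n - μ) + potentialMatrix q V
      = Matrix.diagonal (fun n : fundamentalDomain q => T * symbol q n w)
        + (Matrix.diagonal (fun n : fundamentalDomain q => x * symbol q n u +
          (symbol q n ζ + symbol q (-n) ((T : ℂ) • w + x • u + ζ)⁻¹ - μ))
          + potentialMatrix q V) := by
    intro T
    rw [← add_assoc, Matrix.diagonal_add]
    congr 2
    funext n
    simp only [kineticSymbol, map_add, map_smul, smul_eq_mul]
    ring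
  have hblock : Matrix.diagonal (fun n : {n // p n} => x * symbol q n.1 u) +
        (Matrix.diagonal (fun n : fundamentalDomain q => kineticSymbol q ζ n - μ)
          + potentialMatrix q V).toSquareBlockProp p
      = (Matrix.diagonal (fun n : fundamentalDomain q =>
        x * symbol q n u + (kineticSymbol q ζ n - μ))
          + potentialMatrix q V).toSquareBlockProp p := by
    ext i j
    by_cases hij : i = j
    · subst hij
      simp only [Matrix.toSquareBlockProp_def, Matrix.add_apply, Matrix.of_apply,
        Matrix.diagonal_apply_eq, add_assoc]
    · simp only [Matrix.toSquareBlockProp_def, Matrix.add_apply, Matrix.of_apply,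
        Matrix.diagonal_apply_ne _ hij, Matrix.diagonal_apply_ne _ (Subtype.coe_injective.ne hij),
        zero_add]
  simp only [hpath, hblock]
  exact h

/-! ### Comparison of the two potentials -/

/-- Isospectrality determines the trace of `(C E)²`, where `E` is the block, on the frequencies
at which the forms `L_n(w)` vanish, of the part of the momentum space matrix that stays bounded, and
`C` is the diagonal matrix of signs `L_n(u)`. -/
theorem sum_block_eq {V Y : (Fin d → ℤ) → ℂ} {S : Finset (Fin d)} {μ₁ μ₂ : ℂ}
    {ζ w u : Fin d → ℂ} (hζ : ∀ j, ζ j ≠ 0)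
    (hdet : ∀ z : Fin d → ℂ, (∀ j, z j ≠ 0) → (∀ j, j ∉ S → z j = ζ j) →
      (Matrix.diagonal (fun n : fundamentalDomain q => kineticSymbol q z n - μ₁)
        + potentialMatrix q V).det
      = (Matrix.diagonal (fun n : fundamentalDomain q => kineticSymbol q z n - μ₂)
        + potentialMatrix q Y).det)
    (hwS : ∀ j, j ∉ S → w j = 0) (hw : ∀ j ∈ S, w j ≠ 0) (huS : ∀ j, j ∉ S → u j = 0)
    (p : fundamentalDomain q → Prop) [DecidablePred p]
    (hp : ∀ n : fundamentalDomain q, symbol q n w = 0 ↔ p n)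
    {c : {n : fundamentalDomain q // p n} → ℂ} (hu : ∀ n, symbol q n.1 u = c n)
    (hc : ∀ n, c n ^ 2 = 1) {ζ' : Fin d → ℂ} (hζ' : ζ' = fun j => if j ∈ S then 0 else ζ j)
    {A B : Matrix {n : fundamentalDomain q // p n} {n : fundamentalDomain q // p n} ℂ}
    (hA : A = (Matrix.diagonal (fun n : fundamentalDomain q => kineticSymbol q ζ' n - μ₁)
      + potentialMatrix q V).toSquareBlockProp p)
    (hB : B = (Matrix.diagonal (fun n : fundamentalDomain q => kineticSymbol q ζ' n - μ₂)
      + potentialMatrix q Y).toSquareBlockProp p) :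
    ∑ i, ∑ j, c i * c j * (A i j * A j i) = ∑ i, ∑ j, c i * c j * (B i j * B j i) := by
  refine sum_mul_mul_eq_of_det_pencil_eq hc fun x => ?_
  have hζS : ∀ j ∈ S, ζ' j = 0 := fun j hj => by simp [hζ', hj]
  have h1 := tendsto_det_along_path hwS hw huS hζS V μ₁ x p fun n => (hp n).2
  have h2 := tendsto_det_along_path hwS hw huS hζS Y μ₂ x p fun n => (hp n).2
  simp only [← hA, ← hB, hu] at h1 h2
  have hev : ∀ᶠ T : ℕ in Filter.atTop, ∀ j, ((T : ℂ) • w + x • u + ζ') j ≠ 0 := by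
    refine Filter.eventually_all.2 fun j => ?_
    by_cases hj : j ∈ S
    · -- For a given `x`, at most one value of `T` makes the coordinate vanish.
      have h3 : ∀ᶠ T : ℕ in Filter.atTop, (T : ℂ) ≠ -(x * u j) / w j := by
        have h4 := (Nat.cast_injective (R := ℂ)).tendsto_cofinite
        rw [Nat.cofinite_eq_atTop] at h4
        exact h4.eventually (Set.finite_singleton _).compl_mem_cofinite
      filter_upwards [h3] with T hT h0
      refine hT ?_
      rw [eq_div_iff (hw j hj)]
      simp only [Pi.add_apply, Pi.smul_apply, smul_eq_mul, hζS j hj, add_zero] at h0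
      linear_combination h0
    · refine Filter.Eventually.of_forall fun T => ?_
      simp [hwS j hj, huS j hj, hζ', hj, hζ j]
  have h5 := tendsto_nhds_unique (h1.congr' ?_) h2
  · refine mul_right_cancel₀ (Finset.prod_ne_zero_iff.2 fun n _ => ?_) h5
    exact fun h0 => n.2 ((hp _).1 h0)
  · filter_upwards [hev] with T hT
    rw [hdet _ hT fun j hj => by simp [hwS j hj, huS j hj, hζ', hj]]

/-- Isospectrality transfers the vanishing of all Fourier coefficients at frequencies that are
nontrivial in the coordinates `s` and `t`. -/
theorem fourierCoeff_eq_zero_of_isospectral (hq : ∀ j, 0 < q j)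
    (hcop : Pairwise fun i j => Nat.Coprime (q i) (q j)) {V Y : (Fin d → ℤ) → ℝ}
    (hV : IsPeriodic q V) (hY : IsPeriodic q Y) {S : Finset (Fin d)} (hS : 3 ≤ S.card)
    (hiso : GenPartiallyFermiIsospectral q (fun n => (V n : ℂ)) (fun n => (Y n : ℂ)) S)
    {s t : Fin d} (hsS : s ∈ S) (htS : t ∈ S) (hst : s ≠ t)
    (hVst : ∀ m, ¬ (q s : ℤ) ∣ m s → ¬ (q t : ℤ) ∣ m t →
      fourierCoeff q (fun n => (V n : ℂ)) m = 0)
    {l : Fin d → ℤ} (hl : l ∈ fundamentalDomain q) (hs : ¬ (q s : ℤ) ∣ l s)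
    (ht : ¬ (q t : ℤ) ∣ l t) : fourierCoeff q (fun n => (Y n : ℂ)) l = 0 := by
  classical
  obtain ⟨μ₁, μ₂, ζ, hζ, hdet⟩ := hiso.exists_det_eq hq
    (fun n j => congrArg Complex.ofReal (hV n j)) (fun n j => congrArg Complex.ofReal (hY n j))
  obtain ⟨w, hwS, hw, hw0⟩ := exists_direction hq hcop hS hsS htS hst hl hs ht
  have hph := phase_ne_phase hq hcop hst hs (b := l t)
  obtain ⟨u, huS, hu0, hul⟩ := exists_symbol_eq hph hsS htS 1
  obtain ⟨v, hvS, hv0, hvl⟩ := exists_symbol_eq hph hsS htS (-1)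
  let p : fundamentalDomain q → Prop := fun n =>
    (∀ j ∈ S, (n : Fin d → ℤ) j = 0) ∨ ∀ j ∈ S, (n : Fin d → ℤ) j = l j
  let c : {n // p n} → ℝ := fun n => if ∀ j ∈ S, (n.1 : Fin d → ℤ) j = 0 then 1 else -1
  have hc1 : ∀ n, c n = 1 ∨ c n = -1 := fun n => by
    by_cases h : ∀ j ∈ S, (n.1 : Fin d → ℤ) j = 0
    · exact Or.inl (if_pos h)
    · exact Or.inr (if_neg h)
  have hu : ∀ n : {n // p n}, symbol q n.1 u = 1 := by
    rintro ⟨n, h | h⟩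
    · rw [symbol_congr (m := 0) h huS, hu0]
    · rw [symbol_congr h huS, hul]
  have hv : ∀ n : {n // p n}, symbol q n.1 v = (c n : ℂ) := by
    intro n
    by_cases h : ∀ j ∈ S, (n.1 : Fin d → ℤ) j = 0
    · rw [symbol_congr (m := 0) h hvS, hv0]
      simp [c, if_pos h]
    · rw [symbol_congr (n.2.resolve_left h) hvS, hvl]
      simp [c, if_neg h]
  have e1 := sum_block_eq hζ hdet hwS hw huS p (fun n => hw0 n n.2) (c := fun _ => 1) hu
    (fun _ => one_pow 2) rfl rfl rfl
  have e2 := sum_block_eq hζ hdet hwS hw hvS p (fun n => hw0 n n.2) hv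
    (fun n => by rcases hc1 n with h | h <;> simp [h]) rfl rfl rfl
  -- In the difference of the two traces only the products of off-diagonal entries that couple the
  -- two families of frequencies survive.
  have hentry : ∀ (U : (Fin d → ℤ) → ℝ) (f : fundamentalDomain q → ℂ) (i j : {n // p n}),
      ((1 - c i * c j : ℝ) : ℂ) *
        ((Matrix.diagonal f + potentialMatrix q fun n => (U n : ℂ)).toSquareBlockProp p i j *
          (Matrix.diagonal f + potentialMatrix q fun n => (U n : ℂ)).toSquareBlockProp p j i)
      = (((1 - c i * c j) * Complex.normSq
          (fourierCoeff q (fun n => (U n : ℂ))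
            ((i.1 : Fin d → ℤ) - (j.1 : Fin d → ℤ))) : ℝ) : ℂ) := by
    intro U f i j
    by_cases hij : i = j
    · subst hij
      have : (1 - c i * c i : ℝ) = 0 := by rcases hc1 i with h | h <;> rw [h] <;> norm_num
      rw [this]
      simp
    · have hij' : i.1 ≠ j.1 := Subtype.coe_injective.ne hij
      rw [Complex.ofReal_mul, Complex.normSq_eq_conj_mul_self, conj_fourierCoeff, neg_sub]
      simp only [Matrix.toSquareBlockProp_def, Matrix.add_apply, Matrix.of_apply,
        Matrix.diagonal_apply_ne _ hij', Matrix.diagonal_apply_ne _ hij'.symm, zero_add,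
        potentialMatrix]
      ring
  have e3 := congrArg₂ (fun a b : ℂ => a - b) e1 e2
  simp only [← Finset.sum_sub_distrib, ← sub_mul, mul_one, ← Complex.ofReal_mul,
    ← Complex.ofReal_one, ← Complex.ofReal_sub, hentry] at e3
  norm_cast at e3
  have hVzero : ∀ i j : {n // p n}, (1 - c i * c j) * Complex.normSq (fourierCoeff q
      (fun n => (V n : ℂ)) ((i.1 : Fin d → ℤ) - (j.1 : Fin d → ℤ))) = 0 := by
    intro i j
    by_cases hi : ∀ j ∈ S, (i.1 : Fin d → ℤ) j = 0 <;>
      by_cases hj : ∀ k ∈ S, (j.1 : Fin d → ℤ) k = 0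
    · simp [c, if_pos hi, if_pos hj]
    · have hj' := j.2.resolve_left hj
      rw [hVst, map_zero, mul_zero]
      · simpa [hi s hsS, hj' s hsS] using hs
      · simpa [hi t htS, hj' t htS] using ht
    · have hi' := i.2.resolve_left hi
      rw [hVst, map_zero, mul_zero]
      · simpa [hj s hsS, hi' s hsS] using hs
      · simpa [hj t htS, hi' t htS] using ht
    · simp [c, if_neg hi, if_neg hj]
  simp only [hVzero, Finset.sum_const_zero] at e3
  have hnn : ∀ i j : {n // p n}, 0 ≤ (1 - c i * c j) * Complex.normSq (fourierCoeff q
      (fun n => (Y n : ℂ)) ((i.1 : Fin d → ℤ) - (j.1 : Fin d → ℤ))) := by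
    intro i j
    refine mul_nonneg ?_ (Complex.normSq_nonneg _)
    rcases hc1 i with h | h <;> rcases hc1 j with h' | h' <;> rw [h, h'] <;> norm_num
  let a : {n // p n} := ⟨⟨l, hl⟩, Or.inr fun _ _ => rfl⟩
  let b : {n // p n} := ⟨⟨0, zero_mem_fundamentalDomain hq⟩, Or.inl fun _ _ => rfl⟩
  have e4 := (Finset.sum_eq_zero_iff_of_nonneg fun i _ =>
    Finset.sum_nonneg fun j _ => hnn i j).1 e3.symm a (Finset.mem_univ _)
  have e5 := (Finset.sum_eq_zero_iff_of_nonneg fun j _ => hnn a j).1 e4 b (Finset.mem_univ _)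
  have hca : c a = -1 := if_neg fun h => hs (by
    have h0 : l s = 0 := h s hsS
    rw [h0]
    exact dvd_zero _)
  have hcb : c b = 1 := if_pos fun _ _ => rfl
  rw [hca, hcb] at e5
  simpa [a, b] using e5

end

end PeriodicSchrodinger

theorem theorem3p4 {d : ℕ} (q : Fin d → ℕ) (hq : ∀ j, 0 < q j)
    (hcop : Pairwise fun i j => Nat.Coprime (q i) (q j))
    (V Y : (Fin d → ℤ) → ℝ)
    (hV : PeriodicSchrodinger.IsPeriodic q V) (hY : PeriodicSchrodinger.IsPeriodic q Y)
    (S : Finset (Fin d)) (hS : 3 ≤ S.card)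
    (hiso : PeriodicSchrodinger.GenPartiallyFermiIsospectral q
      (fun n => (V n : ℂ)) (fun n => (Y n : ℂ)) S)
    (s t : Fin d) (hs : s ∈ S) (ht : t ∈ S) (hst : s < t)
    (hsep : PeriodicSchrodinger.IsSeparable (fun n => (V n : ℂ)) s t) :
    PeriodicSchrodinger.IsSeparable (fun n => (Y n : ℂ)) s t := by
  have hVst := fun m hms hmt => hsep.fourierCoeff_eq_zero hq
    (fun n j => congrArg Complex.ofReal (hV n j)) hst.ne (m := m) hms hmt
  refine PeriodicSchrodinger.isSeparable_of_fourierCoeff_eq_zero hq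
    (fun n j => congrArg Complex.ofReal (hY n j)) hst.ne fun m hm hms hmt => ?_
  exact PeriodicSchrodinger.fourierCoeff_eq_zero_of_isospectral hq hcop hV hY hS hiso hs ht hst.ne
    hVst hm hms hmt
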